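/- **Setting.** Consider $N$ qubits on a line. A *$d$-local observable* is a Hermitian operator $A$ with $\|A\|\le 1$ that acts on at most $d$ consecutive qubits. A subspace $\mathcal C\subset(\mathbb C^2)^{\otimes N}$ is an $[[N,k,d,\varepsilon]]$ *approximate quantum error-correcting code* (AQECC) if $\dim\mathcal C=2^k$ and, for every quantum channel $\Lambda$ acting on at most $d$ consecutive qubits, $$\min_{|\psi\rangle}\max_{\mathcal D}\ \langle\psi|(\mathcal D\circ\Lambda\otimes I)(|\psi\rangle\langle\psi|)|\psi\rangle\ \ge\ 1-\varepsilon ,$$ where $|\psi\rangle$ runs over the pure joint states of $\mathcal C$ and a $2^k$-dimensional reference, and $\mathcal D$ over all decoding channels. Let $(\Omega,\mu)$ be a probability space, let $H$ be a (random) Hamiltonian on the $N$ qubits, and let $E\in\mathbb R$, $\Delta\in\mathbb R$, $\beta>0$, $c>0$. Let $S=S(E)$ be the logarithm of the number of eigenvalues of $H$ in $[E-\Delta,E+\Delta]$, counted with multiplicity. Let $|E_1\rangle,\dots,|E_{2^k}\rangle$ be (random) orthonormal eigenstates of $H$ with energies $E_i\in[E-\Delta,E+\Delta]$, and let $\mathcal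 C$ be their span. Assume, almost surely where randomness is involved: 1. (ETH) For every $d$-local observable $A$ there are smooth functions $\mathcal A$ and $f$, and random variables $R_{ij}$ with mean zero and unit variance (for example, but not necessarily, of Gaussian type), with $$\langle E_i|A|E_j\rangle=\mathcal A(E)\,\delta_{ij}+e^{-S/2}f(E,E_i-E_j)\,R_{ij},\qquad |f(E,\omega)|\le c\,e^{-\beta|\omega|/4}\ \text{ for all }\omega .$$ 2. (Narrow shell, extensive entropy) $2\beta\Delta+2\ln N\le S$. 3. (Saturated chaos bound) $\lambda=2\pi/\beta$, where $\lambda$ is the growth rate of the out-of-time-order correlator in the regime $t_d\ll t\ll t_s$. That is, there are times $t_d,t_s$, a ratio $M>1$ with $M^2t_d<t_s$, a tolerance $\eta\in(0,1)$ and a $d$-local observable $A_0$ such that the following holds. Put $\rho=e^{-\beta H}/\mathrm{Tr}\,e^{-\beta H}$, $A=A_0-\mathrm{Tr}(\rho A_0)$, $A(t)=e^{iHt}Ae^{-iHt}$, $F_2(t)=\mathrm{Tr}[\rho^{1/2}A(t)\rho^{1/2}A]$ and $F(t)=\mathrm{Tr}[(\rho^{1/4}A(t)\rho^{1/4}A)^2]$.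 Then for some $F_0>0$ and all $t$ with $Mt_d\le t\le t_s/M$, $$|F_2(t)|\le\eta\,|F_2(0)|,\qquad \bigl|F(t)-F_0\bigl(1-e^{\lambda(t-t_s)}\bigr)\bigr|\le\eta\,F_0\,e^{\lambda(t-t_s)} .$$ **Theorem (chaos–AQEC tradeoff from ETH).** For every $c>0$ there is a constant $K>0$, depending only on $c$, such that in the above setting, for every $\delta\in(0,1)$, with probability at least $1-\delta$ the following holds for every energy difference $\omega=E_i-E_j$ in the code: $\mathcal C$ is an $[[N,k,d,\varepsilon_{\mathrm{code}}]]$ AQECC with $$\varepsilon_{\mathrm{code}}=\frac{K}{\sqrt\delta}\;2^{d+2k}\exp\Bigl(-\frac S4-\frac{\pi}{2\lambda}|\omega|\Bigr).$$ -/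

import Mathlib

open scoped Matrix Kronecker

noncomputable section

namespace ETHCode

/-- Computational basis labels of a chain of `N` qubits. -/
abbrev Conf (N : ℕ) : Type := Fin N → Fin 2

/-- Operators on the `2 ^ N`-dimensional Hilbert space of `N` qubits. -/
abbrev Op (N : ℕ) : Type := Matrix (Conf N) (Conf N) ℂ

/-- Vectors of the Hilbert space of `N` qubits; the inner product is `star u ⬝ᵥ v`. -/
abbrev Ket (N : ℕ) : Type := Conf N → ℂ

/-! ### Locality -/

/-- The (at most) `d` consecutive qubits `a, a + 1, …, a + d - 1` of the chain. -/
def window (N a d : ℕ) : Finset (Fin N) :=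
  Finset.univ.filter fun i => a ≤ i.val ∧ i.val < a + d

/-- `A` acts only on the qubits in `W`: it is `B ⊗ 1` for an operator `B` on those qubits. -/
def ActsOn {N : ℕ} (W : Finset (Fin N)) (A : Op N) : Prop :=
  ∃ B : Matrix (W → Fin 2) (W → Fin 2) ℂ, ∀ x y : Conf N,
    ((∀ i, i ∉ W → x i = y i) → A x y = B (fun i => x i) (fun i => y i)) ∧
    (¬ (∀ i, i ∉ W → x i = y i) → A x y = 0)

open scoped Matrix.Norms.L2Operator in
/-- A `d`-local observable, normalized to operator norm at most one. -/
structure IsLocalObservable {N : ℕ} (d : ℕ) (A : Op N) : Prop where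
  hermitian : A.IsHermitian
  isLocal : ∃ a, ActsOn (window N a d) A
  norm_le : ‖A‖ ≤ 1

/-! ### Channels and approximate quantum error-correcting codes -/

/-- The Kraus operators of a quantum channel. -/
def IsKraus {N m : ℕ} (K : Fin m → Op N) : Prop :=
  ∑ a, (K a)ᴴ * K a = 1

/-- The channel with Kraus operators `K`, tensored with the identity of a reference system `R`. -/
def applyKraus {N m : ℕ} {R : Type} [Fintype R] [DecidableEq R] (K : Fin m → Op N)
    (ρ : Matrix (Conf N × R) (Conf N × R) ℂ) : Matrix (Conf N × R) (Conf N × R) ℂ :=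
  ∑ a, (K a ⊗ₖ (1 : Matrix R R ℂ)) * ρ * (K a ⊗ₖ (1 : Matrix R R ℂ))ᴴ

/-- `⟨ψ| (𝒟 ∘ Λ ⊗ I)(|ψ⟩⟨ψ|) |ψ⟩`, where `E`, `D` are Kraus operators of the noise `Λ` and of the
decoder `𝒟`. -/
def recoveryFidelity {N m n : ℕ} {R : Type} [Fintype R] [DecidableEq R] (E : Fin m → Op N)
    (D : Fin n → Op N) (ψ : Conf N × R → ℂ) : ℝ :=
  (star ψ ⬝ᵥ (applyKraus D (applyKraus E (Matrix.vecMulVec ψ (star ψ))) *ᵥ ψ)).re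

/-- `C` is an `[[N, k, d, ε]]` approximate quantum error-correcting code: it has dimension `2 ^ k`,
and for every channel on at most `d` consecutive qubits and every pure joint state of `C` and a
reference of dimension `2 ^ k` some decoding channel has fidelity at least `1 - ε`. -/
structure IsAQECC {N : ℕ} (k d : ℕ) (ε : ℝ) (C : Submodule ℂ (Ket N)) : Prop where
  finrank_eq : Module.finrank ℂ C = 2 ^ k
  correctable : ∀ (a m : ℕ) (E : Fin m → Op N), IsKraus E →
    (∀ l, ActsOn (window N a d) (E l)) →
    ∀ ψ : Conf N × Fin (2 ^ k) → ℂ, (∀ r, (fun q => ψ (q, r)) ∈ C) → star ψ ⬝ᵥ ψ = 1 →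
    ∃ (n : ℕ) (D : Fin n → Op N), IsKraus D ∧ 1 - ε ≤ recoveryFidelity E D ψ

/-! ### Thermal correlators and the growth rate -/

/-- The power `ρ ^ p` of the thermal state `ρ = exp (-β H) / Tr exp (-β H)`. -/
def thermalPow {N : ℕ} (H : Op N) (β p : ℝ) : Op N :=
  (((NormedSpace.exp (-(β : ℂ) • H)).trace.re ^ (-p) : ℝ) : ℂ) •
    NormedSpace.exp (-((p * β : ℝ) : ℂ) • H)

/-- The Heisenberg operator `A(t) = exp (i H t) A exp (-i H t)`. -/
def heisenberg {N : ℕ} (H A : Op N) (t : ℝ) : Op N :=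
  NormedSpace.exp ((Complex.I * (t : ℂ)) • H) * A * NormedSpace.exp (-(Complex.I * (t : ℂ)) • H)

/-- `A - Tr (ρ A)`. -/
def centred {N : ℕ} (H A : Op N) (β : ℝ) : Op N :=
  A - (thermalPow H β 1 * A).trace • (1 : Op N)

/-- `Tr [ρ^(1/2) A(t) ρ^(1/2) A]`. -/
def twoPoint {N : ℕ} (H A : Op N) (β t : ℝ) : ℂ :=
  (thermalPow H β (1 / 2) * heisenberg H A t * thermalPow H β (1 / 2) * A).trace

/-- `Tr [ρ^(1/4) A(t) ρ^(1/4) A ρ^(1/4) A(t) ρ^(1/4) A]`. -/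
def otoc {N : ℕ} (H A : Op N) (β t : ℝ) : ℂ :=
  (thermalPow H β (1 / 4) * heisenberg H A t * thermalPow H β (1 / 4) * A *
    thermalPow H β (1 / 4) * heisenberg H A t * thermalPow H β (1 / 4) * A).trace

/-- `lam` is the growth rate of the out-of-time-order correlator of the centred observable `A` in
the regime `td ≪ t ≪ ts`. Here `≪` means smaller by a factor `M > 1`; in that regime the two-point
function has decayed to a fraction `η` of its initial value, and the correlator is proportional to
`1 - exp (lam (t - ts))` up to a relative error `η < 1` of the growing term. (For a finite system
the correlator is a finite sum of oscillating exponentials, so an exact equality cannot hold.) -/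
structure HasGrowthRate {N : ℕ} (H A : Op N) (β lam td ts M η : ℝ) : Prop where
  td_pos : 0 < td
  one_lt : 1 < M
  separated : M ^ 2 * td < ts
  tol_pos : 0 < η
  tol_lt_one : η < 1
  dissipation : ∀ t, M * td ≤ t → M * t ≤ ts →
    ‖twoPoint H (centred H A β) β t‖ ≤ η * ‖twoPoint H (centred H A β) β 0‖
  growth : ∃ F₀ : ℝ, 0 < F₀ ∧ ∀ t, M * td ≤ t → M * t ≤ ts →
    ‖otoc H (centred H A β) β t - ((F₀ * (1 - Real.exp (lam * (t - ts))) : ℝ) : ℂ)‖ ≤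
      η * (F₀ * Real.exp (lam * (t - ts)))

/-! ### The microcanonical shell and the eigenstate thermalization ansatz -/

/-- The span of all eigenvectors of `H` with energy in `[E - Δ, E + Δ]`. -/
def shell {N : ℕ} (H : Op N) (E Δ : ℝ) : Submodule ℂ (Ket N) :=
  ⨆ e ∈ Set.Icc (E - Δ) (E + Δ), Module.End.eigenspace (Matrix.toLin' H) (e : ℂ)

/-- Microcanonical entropy: the logarithm of the number of energy levels in the shell, counted with
multiplicity. -/
def microEntropy {N : ℕ} (H : Op N) (E Δ : ℝ) : ℝ :=
  Real.log (Module.finrank ℂ (shell H E Δ))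

/-- `ψ` is an orthonormal family of eigenstates of `H`, with energies `e` in `[E - Δ, E + Δ]`. -/
structure IsShellFamily {N : ℕ} {ι : Type} [DecidableEq ι] (H : Op N) (E Δ : ℝ) (e : ι → ℝ)
    (ψ : ι → Ket N) : Prop where
  orthonormal : ∀ i j, star (ψ i) ⬝ᵥ ψ j = if i = j then 1 else 0
  eigen : ∀ i, H *ᵥ ψ i = (e i : ℂ) • ψ i
  mem_shell : ∀ i, e i ∈ Set.Icc (E - Δ) (E + Δ)

/-- The eigenstate thermalization ansatz at energy `E` for the observable `A`, in the random states
`ψ x i` with energies `e x i` and entropy `S x`: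
`⟨E_i| A |E_j⟩ = 𝒜(E) δ_ij + exp (-S / 2) f(E, E_i - E_j) R_ij`,
with smooth `𝒜` and `f`, an envelope `|f(E, ω)| ≤ c exp (-β |ω| / 4)`, and random variables `R_ij`
of mean zero and unit variance. Their law is not restricted further, so this contains the Gaussian
case; exactly Gaussian matrix elements of a bounded operator would be unbounded, hence impossible
unless `f` vanishes. No independence is assumed. -/
def SatisfiesETH {N : ℕ} {ι Ω : Type*} [DecidableEq ι] [MeasurableSpace Ω]
    (μ : MeasureTheory.Measure Ω) (β c E : ℝ) (S : Ω → ℝ) (e : Ω → ι → ℝ) (ψ : Ω → ι → Ket N)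
    (A : Op N) : Prop :=
  ∃ (avg : ℝ → ℝ) (f : ℝ → ℝ → ℝ) (R : ι → ι → Ω → ℂ),
    ContDiff ℝ (⊤ : ℕ∞) avg ∧
    ContDiff ℝ (⊤ : ℕ∞) (fun p : ℝ × ℝ => f p.1 p.2) ∧
    (∀ ω, |f E ω| ≤ c * Real.exp (-(β / 4) * |ω|)) ∧
    (∀ i j, MeasureTheory.MemLp (R i j) 2 μ ∧ ∫ x, R i j x ∂μ = 0 ∧ ∫ x, ‖R i j x‖ ^ 2 ∂μ = 1) ∧
    ∀ᵐ x ∂μ, ∀ i j, star (ψ x i) ⬝ᵥ (A *ᵥ ψ x j) =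
      (if i = j then (avg E : ℂ) else 0) +
        ((Real.exp (-S x / 2) * f E (e x i - e x j) : ℝ) : ℂ) * R i j x

end ETHCode

end

/-! The ansatz is an approximate Knill–Laflamme condition: in the code basis every local observable
is a multiple of the identity up to entries of second moment at most `c ^ 2 * exp (-S)`. The proof
makes this uniform over all local operators with one random variable, then builds a decoder
deterministically.

Uniformity. Operators on a window expand in at most `4 ^ d` shift-and-phase unitaries, with
coefficients bounded in ℓ² by the operator norm (`ActsOn.exists_eq_sum_smul_embed_weyl`). By
Cauchy–Schwarz it is enough to control these finitely many unitaries. Their normalized squared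
fluctuations, summed over windows, unitaries and matrix entries, are dominated by one variable `Z`
of mean at most `(N + 1) * 4 ^ d * 4 * 4 ^ k` (`exists_uniform_fluctuation_bound`). Markov's
inequality gives one good event of probability at least `1 - δ`, with violation `κ = c * exp (-S /
2) * √t` and `t` the mean bound divided by `δ`.

Decoding. Noise is correctable when the environment and the reference end up nearly uncorrelated.
`exists_decoder` compares their joint state with a product state in trace norm. An Uhlmann argument
(`exists_isometry_overlap_ge`, resting on Powers–Størmer) turns closeness into a decoder of
infidelity at most `2 * κ * 2 ^ k`, whatever the number of Kraus operators.

Exponent. Together these give `8 * c / √δ * 2 ^ (d + 2 * k) * exp (-S / 2) * √N` for `N ≥ 1`. All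
gaps in the shell satisfy `|ω| ≤ 2 * Δ`, so the shell condition gives `S / 4 ≥ β * |ω| / 4 + log N /
2`: half of the exponent `S / 2` pays for both `√N` and the factor in `|ω|`. The saturated rate
identifies `β / 4` with `π / (2 * lam)`. -/

noncomputable section

namespace ETHCode

open Matrix

/-! ### Powers–Størmer, isometries from Gram matrices, and Uhlmann's theorem. -/

section LinearAlgebra

variable {m n p : Type*} [Fintype m] [Fintype n] [Fintype p]

open scoped Matrix.Norms.L2Operator MatrixOrder ComplexOrder in
/-- A positive semidefinite matrix has a positive semidefinite square root. -/
theorem exists_posSemidef_mul_self_eq [DecidableEq n] {A : Matrix n n ℂ} (hA : A.PosSemidef) :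
    ∃ T : Matrix n n ℂ, T.PosSemidef ∧ T * T = A :=
  ⟨CFC.sqrt A, (CFC.sqrt_nonneg A).posSemidef, CFC.sqrt_mul_sqrt_self A hA.nonneg⟩

open scoped ComplexOrder in
/-- The Powers–Størmer inequality, with the trace norm on the right witnessed by a unitary. -/
theorem exists_unitary_trace_sub_sq_le [DecidableEq n] {A B : Matrix n n ℂ} (hA : A.PosSemidef)
    (hB : B.PosSemidef) :
    ∃ S : Matrix n n ℂ, Sᴴ * S = 1 ∧
      ((A - B) * (A - B)).trace.re ≤ ((A * A - B * B) * S).trace.re := by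
  have hAB : (A - B).IsHermitian := hA.1.sub hB.1
  set U : Matrix n n ℂ := hAB.eigenvectorUnitary.1
  set d := hAB.eigenvalues
  have hU1 : Uᴴ * U = 1 := by
    have := Unitary.coe_star_mul_self hAB.eigenvectorUnitary
    rwa [star_eq_conjTranspose] at this
  have hU2 : U * Uᴴ = 1 := mul_eq_one_comm.mp hU1
  set A' := Uᴴ * A * U with hA'
  set B' := Uᴴ * B * U with hB'
  have hdiag : A' - B' = diagonal (fun i => (d i : ℂ)) := by
    have h := hAB.spectral_theorem
    rw [Unitary.conjStarAlgAut_apply] at h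
    have h2 : A - B = U * diagonal (fun i => (d i : ℂ)) * Uᴴ := h
    calc A' - B' = Uᴴ * (A - B) * U := by rw [hA', hB']; noncomm_ring
      _ = (Uᴴ * U) * diagonal (fun i => (d i : ℂ)) * (Uᴴ * U) := by rw [h2]; noncomm_ring
      _ = _ := by rw [hU1]; simp
  have hA'p : A'.PosSemidef := hA.conjTranspose_mul_mul_same U
  have hB'p : B'.PosSemidef := hB.conjTranspose_mul_mul_same U
  -- The sign of `A - B` in its eigenbasis, with value 1 at zero so that it stays unitary.
  let s : n → ℂ := fun i => if 0 ≤ d i then 1 else -1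
  have hss : ∀ i, star (s i) * s i = 1 := by
    intro i; by_cases h : 0 ≤ d i <;> simp [s, h]
  refine ⟨U * diagonal s * Uᴴ, ?_, ?_⟩
  · calc (U * diagonal s * Uᴴ)ᴴ * (U * diagonal s * Uᴴ)
        = U * ((diagonal s)ᴴ * (Uᴴ * U) * diagonal s) * Uᴴ := by
          simp only [conjTranspose_mul, conjTranspose_conjTranspose]; noncomm_ring
      _ = 1 := by
          rw [hU1, mul_one, diagonal_conjTranspose, diagonal_mul_diagonal]
          have : (fun i => star s i * s i) = fun _ => 1 := funext hss
          rw [this, diagonal_one, mul_one, hU2]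
  · have h1 : ((A - B) * (A - B)).trace = ((A' - B') * (A' - B')).trace := by
      have : (A' - B') * (A' - B') = Uᴴ * ((A - B) * (U * Uᴴ) * (A - B)) * U := by
        rw [hA', hB']; noncomm_ring
      rw [this, hU2, mul_one, trace_mul_cycle, hU2, one_mul]
    have h2 : ((A * A - B * B) * (U * diagonal s * Uᴴ)).trace
        = ((A' * A' - B' * B') * diagonal s).trace := by
      have : A' * A' - B' * B' = Uᴴ * (A * (U * Uᴴ) * A - B * (U * Uᴴ) * B) * U := by
        rw [hA', hB']; noncomm_ring
      rw [this, hU2, mul_one, mul_one, ← mul_assoc, ← mul_assoc, trace_mul_comm]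
      simp only [mul_assoc]
    rw [h1, h2, hdiag, diagonal_mul_diagonal, trace_diagonal]
    -- In the eigenbasis the `i`-th term on the right becomes `|d i| * (A' i i + B' i i)`. It
    -- dominates `d i ^ 2` because `d i = A' i i - B' i i` with both entries nonnegative.
    have h3 : A' * A' - B' * B' = A' * (A' - B') + (A' - B') * B' := by noncomm_ring
    rw [h3, hdiag, trace]
    simp only [diag_apply, mul_diagonal, Matrix.add_apply, diagonal_mul]
    rw [Complex.re_sum, Complex.re_sum]
    refine Finset.sum_le_sum fun i _ => ?_
    have hAi := (Complex.le_def.mp (hA'p.diag_nonneg (i := i)))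
    have hBi := (Complex.le_def.mp (hB'p.diag_nonneg (i := i)))
    have hdi : A' i i - B' i i = d i := by
      rw [← Matrix.sub_apply, hdiag, diagonal_apply_eq]
    have hre : (A' i i).re - (B' i i).re = d i := by
      rw [← Complex.sub_re, hdi, Complex.ofReal_re]
    have ha := hAi.1
    have hb := hBi.1
    simp only [Complex.zero_re] at ha hb
    by_cases h : 0 ≤ d i
    · simp [s, h]; nlinarith
    · simp [s, h]; nlinarith

/-- Two matrices with the same Gram matrix differ by an isometry of the column space. -/
theorem exists_isometry_mul_eq [DecidableEq m] [DecidableEq n] [DecidableEq p]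
    (hcard : Fintype.card m ≤ Fintype.card p)
    (A : Matrix m n ℂ) (B : Matrix p n ℂ) (h : Aᴴ * A = Bᴴ * B) :
    ∃ W : Matrix p m ℂ, Wᴴ * W = 1 ∧ W * A = B := by
  obtain ⟨f⟩ := Function.Embedding.nonempty_of_card_le hcard
  -- Padding the rows of `A` puts both ranges in the same space, where a partial isometry extends to
  -- a unitary.
  let F : Matrix p m ℂ := (1 : Matrix p p ℂ).submatrix id f
  have hF : Fᴴ * F = 1 := by
    ext i j
    simp [F, mul_apply, one_apply, f.injective.eq_iff, eq_comm]
  have hgram : (F * A)ᴴ * (F * A) = Bᴴ * B := by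
    rw [conjTranspose_mul, ← h, Matrix.mul_assoc, ← Matrix.mul_assoc Fᴴ, hF, Matrix.one_mul]
  set a := toEuclideanLin (𝕜 := ℂ) (F * A)
  set b := toEuclideanLin (𝕜 := ℂ) B
  have hnorm : ∀ v, ‖a v‖ = ‖b v‖ := by
    have key : ∀ (C : Matrix p n ℂ) (v : EuclideanSpace ℂ n),
        ((‖toEuclideanLin (𝕜 := ℂ) C v‖ ^ 2 : ℝ) : ℂ) = star v.ofLp ⬝ᵥ ((Cᴴ * C) *ᵥ v.ofLp) := by
      intro C v
      have := inner_self_eq_norm_sq_to_K (𝕜 := ℂ) (toEuclideanLin (𝕜 := ℂ) C v)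
      rw [EuclideanSpace.inner_eq_star_dotProduct] at this
      rw [← mulVec_mulVec, dotProduct_mulVec, ← star_mulVec, dotProduct_comm]
      push_cast
      exact this.symm
    intro v
    have h2 : (‖a v‖ ^ 2 : ℝ) = ‖b v‖ ^ 2 := by
      have := (key (F * A) v).trans ((congrArg _ (by rw [hgram])).trans (key B v).symm)
      exact_mod_cast this
    exact (pow_left_inj₀ (norm_nonneg _) (norm_nonneg _) two_ne_zero).mp h2
  -- The map `a v ↦ b v` is well defined and isometric on the range of `a`, since `‖a v‖ = ‖b v‖`;
  -- `g` merely selects preimages.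
  obtain ⟨g, hg⟩ := LinearMap.exists_rightInverse_of_surjective a.rangeRestrict
    a.range_rangeRestrict
  have hg' : ∀ y, a (g y) = y := fun y => congrArg Subtype.val (LinearMap.congr_fun hg y)
  let L : LinearMap.range a →ₗᵢ[ℂ] EuclideanSpace ℂ p :=
    ⟨b ∘ₗ g, fun y => by
      rw [LinearMap.comp_apply, ← hnorm, hg', Submodule.coe_norm]⟩
  have hL : ∀ v, L.extend (a v) = b v := by
    intro v
    have h1 := L.extend_apply ⟨a v, v, rfl⟩
    rw [h1]
    change b (g _) = b v
    rw [← sub_eq_zero, ← map_sub, ← norm_eq_zero, ← hnorm, map_sub, hg', sub_self, norm_zero]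
  let U : Matrix p p ℂ := toEuclideanLin.symm L.extend.toLinearMap
  have hUapp : toEuclideanLin U = L.extend.toLinearMap := toEuclideanLin.apply_symm_apply _
  have hUU : Uᴴ * U = 1 := by
    ext i j
    have h1 := L.extend.inner_map_map (EuclideanSpace.single i 1) (EuclideanSpace.single j 1)
    have h2 : ∀ k, L.extend (EuclideanSpace.single k 1) = WithLp.toLp 2 (U.col k) := by
      intro k
      have : L.extend (EuclideanSpace.single k 1)
        = toEuclideanLin U (EuclideanSpace.single k 1) := by rw [hUapp]; rfl
      rw [this]
      ext i
      simp [toLpLin_apply]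
    rw [h2, h2, EuclideanSpace.inner_eq_star_dotProduct] at h1
    simp only [EuclideanSpace.inner_single_left, map_one, one_mul] at h1
    have h3 : ∑ k, U k j * star (U k i) = if i = j then 1 else 0 :=
      h1.trans (PiLp.single_apply 2 ℂ j 1 i)
    rw [mul_apply, one_apply, ← h3]
    exact Finset.sum_congr rfl fun k _ => mul_comm _ _
  refine ⟨U * F, ?_, ?_⟩
  · rw [conjTranspose_mul, Matrix.mul_assoc, ← Matrix.mul_assoc Uᴴ, hUU, Matrix.one_mul, hF]
  · apply toEuclideanLin.injective
    ext1 v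
    calc toEuclideanLin (U * F * A) v = toEuclideanLin U (a v) := by
          simp [a, toLpLin_apply, mulVec_mulVec, Matrix.mul_assoc]
      _ = L.extend (a v) := by rw [hUapp]; rfl
      _ = b v := hL v

open scoped ComplexOrder in
/-- A quantitative Uhlmann theorem: if `Aᴴ A` and `Bᴴ B` are close in trace norm, an isometry
brings `A` close to `B`. -/
theorem exists_isometry_overlap_ge [DecidableEq m] [DecidableEq n] [DecidableEq p]
    (hmp : Fintype.card m ≤ Fintype.card p) (hnp : Fintype.card n ≤ Fintype.card p)
    (A : Matrix m n ℂ) (B : Matrix p n ℂ) (hA : (Aᴴ * A).trace = 1) (hB : (Bᴴ * B).trace = 1)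
    {r : ℝ} (hr : ∀ S : Matrix n n ℂ, Sᴴ * S = 1 → ‖((Aᴴ * A - Bᴴ * B) * S).trace‖ ≤ r) :
    ∃ W : Matrix p m ℂ, Wᴴ * W = 1 ∧ 1 - r / 2 ≤ ((Bᴴ * (W * A)).trace).re := by
  -- With polar decompositions, `W` can be chosen so that the overlap is exactly `Tr (b a)`, which
  -- equals `1 - Tr (a - b)² / 2`; Powers–Størmer bounds the last trace by `r`.
  obtain ⟨a, hap, ha⟩ := exists_posSemidef_mul_self_eq (posSemidef_conjTranspose_mul_self A)
  obtain ⟨b, hbp, hb⟩ := exists_posSemidef_mul_self_eq (posSemidef_conjTranspose_mul_self B)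
  obtain ⟨U, hU, hUb⟩ := exists_isometry_mul_eq hnp b B (by rw [hbp.1, hb])
  obtain ⟨W, hW, hWA⟩ := exists_isometry_mul_eq hmp A (U * a) (by
    rw [conjTranspose_mul, Matrix.mul_assoc, ← Matrix.mul_assoc Uᴴ, hU, Matrix.one_mul, hap.1, ha])
  refine ⟨W, hW, ?_⟩
  obtain ⟨S, hS, hle⟩ := exists_unitary_trace_sub_sq_le hap hbp
  rw [ha, hb] at hle
  have h1 := (hle.trans (Complex.re_le_norm _)).trans (hr S hS)
  have h2 : Bᴴ * (W * A) = b * a := by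
    rw [hWA, ← hUb, conjTranspose_mul, hbp.1, Matrix.mul_assoc, ← Matrix.mul_assoc Uᴴ, hU,
      Matrix.one_mul]
  have h3 : ((a - b) * (a - b)).trace = 2 - 2 * (b * a).trace := by
    have : (a - b) * (a - b) = a * a + b * b - a * b - b * a := by noncomm_ring
    rw [this, trace_sub, trace_sub, trace_add, ha, hb, hA, hB, trace_mul_comm a b]
    ring
  rw [h3] at h1
  rw [h2]
  simp at h1
  linarith

open scoped Matrix.Norms.L2Operator in
theorem sum_norm_sq_col_le_l2_opNorm_sq [DecidableEq n] (A : Matrix m n ℂ) (j : n) :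
    ∑ i, ‖A i j‖ ^ 2 ≤ ‖A‖ ^ 2 := by
  have h := A.l2_opNorm_mulVec (EuclideanSpace.single j 1)
  rw [PiLp.norm_single, norm_one, mul_one] at h
  have h2 := pow_le_pow_left₀ (norm_nonneg _) h 2
  rw [EuclideanSpace.norm_sq_eq] at h2
  simpa using h2

open scoped Matrix.Norms.L2Operator in
theorem l2_opNorm_le_of_conjTranspose_mul_self [DecidableEq m] [DecidableEq n] [Nonempty n]
    (A : Matrix m n ℂ) {r : ℝ} (hr : 0 ≤ r) (h : Aᴴ * A = ((r ^ 2 : ℝ) : ℂ) • 1) : ‖A‖ ≤ r := by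
  have h1 := A.l2_opNorm_conjTranspose_mul_self
  rw [h, norm_smul, CStarRing.norm_one, mul_one] at h1
  simp only [Complex.norm_real, Real.norm_eq_abs, abs_of_nonneg (sq_nonneg r)] at h1
  nlinarith [norm_nonneg A]

end LinearAlgebra

/-! ### The shift and phase operators of a finite abelian group -/

section Weyl

variable {G : Type} [AddCommGroup G] [Fintype G] [DecidableEq G]

/-- The unitary `|x + s⟩ ↤ |x⟩` followed by the phase `χ`. -/
def weyl (w : G × AddChar G ℂ) : Matrix G G ℂ :=
  Matrix.of fun x y => if y = x + w.1 then w.2 x else 0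

theorem conjTranspose_weyl_mul_self (w : G × AddChar G ℂ) : (weyl w)ᴴ * weyl w = 1 := by
  rw [mul_eq_one_comm]
  ext x y
  rw [mul_apply, one_apply]
  by_cases h : x = y
  · subst h
    simp [weyl, conjTranspose_apply, apply_ite, Complex.mul_conj, Complex.normSq_eq_norm_sq,
      AddChar.norm_apply]
  · simp [weyl, conjTranspose_apply, h]

/-- The shift and phase operators are an orthogonal basis of all matrices. -/
theorem exists_eq_sum_smul_weyl (B : Matrix G G ℂ) :
    ∃ o : G × AddChar G ℂ → ℂ, B = ∑ w, o w • weyl w ∧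
      ∑ w, ‖o w‖ ^ 2 = (Fintype.card G : ℝ)⁻¹ * ∑ x, ∑ y, ‖B x y‖ ^ 2 := by
  have hG : (Fintype.card G : ℂ) ≠ 0 := by simp
  have horth : ∀ x z : G, ∑ χ : AddChar G ℂ, star (χ z) * χ x
      = if x = z then (Fintype.card G : ℂ) else 0 := by
    intro x z
    have := AddChar.sum_apply_eq_ite (x - z)
    simp only [sub_eq_zero] at this
    rw [← this]
    refine Finset.sum_congr rfl fun χ _ => ?_
    rw [AddChar.map_sub_eq_div, div_eq_mul_inv, mul_comm, ← AddChar.map_neg_eq_inv,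
      AddChar.map_neg_eq_conj]
    rfl
  -- Fourier coefficients of `B` along the shifted diagonal `y = x + s`.
  let o : G × AddChar G ℂ → ℂ := fun w =>
    (Fintype.card G : ℂ)⁻¹ * ∑ z, star (w.2 z) * B z (z + w.1)
  refine ⟨o, ?_, ?_⟩
  · ext x y
    rw [Matrix.sum_apply, Fintype.sum_prod_type]
    have hy : ∀ s, y = x + s ↔ s = y - x := fun s => by
      constructor <;> rintro rfl <;> simp
    simp only [Matrix.smul_apply, weyl, Matrix.of_apply, smul_eq_mul, mul_ite, mul_zero, hy, o]
    rw [Finset.sum_comm]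
    simp only [Finset.sum_ite_eq', Finset.mem_univ, if_true]
    have : ∀ χ : AddChar G ℂ, (Fintype.card G : ℂ)⁻¹ *
        (∑ z, star (χ z) * B z (z + (y - x))) * χ x
        = ∑ z, (Fintype.card G : ℂ)⁻¹ * B z (z + (y - x)) * (star (χ z) * χ x) := by
      intro χ
      rw [Finset.mul_sum, Finset.sum_mul]
      exact Finset.sum_congr rfl fun z _ => by ring
    simp only [this]
    rw [Finset.sum_comm]
    simp only [← Finset.mul_sum, horth, mul_ite, mul_zero]
    simp [hG, mul_comm]
  -- Parseval on each shifted diagonal separately.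
  · have key : ∀ s : G, ((∑ χ : AddChar G ℂ, ‖o (s, χ)‖ ^ 2 : ℝ) : ℂ)
        = (Fintype.card G : ℂ)⁻¹ * ∑ z, ((‖B z (z + s)‖ ^ 2 : ℝ) : ℂ) := by
      intro s
      have h1 : ∀ χ : AddChar G ℂ, ((‖o (s, χ)‖ ^ 2 : ℝ) : ℂ)
          = ∑ x, ∑ z, (Fintype.card G : ℂ)⁻¹ * (Fintype.card G : ℂ)⁻¹ *
            (B x (x + s) * star (B z (z + s))) * (star (χ x) * χ z) := by
        intro χ
        rw [← Complex.normSq_eq_norm_sq, Complex.normSq_eq_conj_mul_self]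
        simp only [o, map_mul, map_sum, map_inv₀, Complex.conj_natCast]
        simp only [starRingEnd_apply, star_star]
        rw [mul_mul_mul_comm, Finset.sum_mul_sum, Finset.sum_comm, Finset.mul_sum]
        refine Finset.sum_congr rfl fun x _ => ?_
        rw [Finset.mul_sum]
        exact Finset.sum_congr rfl fun z _ => by ring
      push_cast at h1 ⊢
      simp only [h1]
      rw [Finset.sum_comm, Finset.mul_sum]
      refine Finset.sum_congr rfl fun x _ => ?_
      rw [Finset.sum_comm]
      simp only [← Finset.mul_sum, horth, mul_ite, mul_zero]
      rw [Finset.sum_ite_eq' Finset.univ x]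
      simp only [Finset.mem_univ, if_true]
      have : B x (x + s) * star (B x (x + s)) = (‖B x (x + s)‖ : ℂ) ^ 2 := Complex.mul_conj' _
      rw [this]
      field_simp
    have key2 : ∀ s : G, (∑ χ : AddChar G ℂ, ‖o (s, χ)‖ ^ 2 : ℝ)
        = (Fintype.card G : ℝ)⁻¹ * ∑ z, ‖B z (z + s)‖ ^ 2 := fun s => by
      apply Complex.ofReal_injective
      rw [key s]
      push_cast
      rfl
    rw [Fintype.sum_prod_type]
    simp only [key2]
    rw [← Finset.mul_sum, Finset.sum_comm]
    congr 1
    refine Finset.sum_congr rfl fun x _ => ?_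
    exact Equiv.sum_comp (Equiv.addLeft x) fun y => ‖B x y‖ ^ 2

end Weyl

/-! ### Operators supported on a set of qubits -/

section Embed

variable {N : ℕ} {W : Finset (Fin N)}

/-- Split a configuration into its restrictions to `W` and to the complement of `W`. -/
def splitConf (W : Finset (Fin N)) : Conf N ≃ (W → Fin 2) × ({i // i ∉ W} → Fin 2) :=
  Equiv.piEquivPiSubtypeProd (· ∈ W) fun _ => Fin 2

/-- The operator `B ⊗ 1` on the whole chain. -/
def embed (W : Finset (Fin N)) (B : Matrix (W → Fin 2) (W → Fin 2) ℂ) : Op N :=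
  (B ⊗ₖ (1 : Matrix ({i // i ∉ W} → Fin 2) ({i // i ∉ W} → Fin 2) ℂ)).submatrix
    (splitConf W) (splitConf W)

theorem actsOn_iff_exists_embed {A : Op N} : ActsOn W A ↔ ∃ B, A = embed W B := by
  have key : ∀ (B : Matrix (W → Fin 2) (W → Fin 2) ℂ) (x y : Conf N), embed W B x y
      = if ∀ i, i ∉ W → x i = y i then B (fun i => x i) (fun i => y i) else 0 := by
    intro B x y
    by_cases h : ∀ i, i ∉ W → x i = y i
    · have : (splitConf W x).2 = (splitConf W y).2 := funext fun i => h i i.2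
      rw [if_pos h, embed, submatrix_apply, kroneckerMap_apply, this, one_apply_eq, mul_one]
      rfl
    · have : (splitConf W x).2 ≠ (splitConf W y).2 := fun h' => h fun i hi => congrFun h' ⟨i, hi⟩
      simp only [embed, submatrix_apply, kroneckerMap_apply, one_apply_ne this, mul_zero, if_neg h]
  constructor
  · rintro ⟨B, hB⟩
    refine ⟨B, ?_⟩
    ext x y
    rw [key]
    split_ifs with h
    · exact (hB x y).1 h
    · exact (hB x y).2 h
  · rintro ⟨B, rfl⟩
    exact ⟨B, fun x y => ⟨fun h => by rw [key, if_pos h], fun h => by rw [key, if_neg h]⟩⟩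

theorem embed_one : embed W 1 = 1 := by
  rw [embed, one_kronecker_one, submatrix_one_equiv]

theorem embed_mul (A B : Matrix (W → Fin 2) (W → Fin 2) ℂ) :
    embed W (A * B) = embed W A * embed W B := by
  rw [embed, embed, embed, submatrix_mul_equiv, ← mul_kronecker_mul, mul_one]

theorem embed_conjTranspose (A : Matrix (W → Fin 2) (W → Fin 2) ℂ) :
    embed W Aᴴ = (embed W A)ᴴ := by
  rw [embed, embed, conjTranspose_submatrix, conjTranspose_kronecker, conjTranspose_one]

theorem embed_add (A B : Matrix (W → Fin 2) (W → Fin 2) ℂ) :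
    embed W (A + B) = embed W A + embed W B := by
  rw [embed, embed, embed, add_kronecker]; rfl

theorem embed_smul (c : ℂ) (A : Matrix (W → Fin 2) (W → Fin 2) ℂ) :
    embed W (c • A) = c • embed W A := by
  rw [embed, embed, smul_kronecker]; rfl

theorem embed_sum {ι : Type*} (s : Finset ι) (A : ι → Matrix (W → Fin 2) (W → Fin 2) ℂ) :
    embed W (∑ i ∈ s, A i) = ∑ i ∈ s, embed W (A i) := by
  classical
  induction s using Finset.induction_on with
  | empty => simp [embed]
  | insert i s hi ih => rw [Finset.sum_insert hi, Finset.sum_insert hi, embed_add, ih]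

theorem ActsOn.mul {A B : Op N} (hA : ActsOn W A) (hB : ActsOn W B) : ActsOn W (A * B) := by
  rw [actsOn_iff_exists_embed] at *
  obtain ⟨a, rfl⟩ := hA
  obtain ⟨b, rfl⟩ := hB
  exact ⟨a * b, (embed_mul a b).symm⟩

theorem ActsOn.add {A B : Op N} (hA : ActsOn W A) (hB : ActsOn W B) : ActsOn W (A + B) := by
  rw [actsOn_iff_exists_embed] at *
  obtain ⟨a, rfl⟩ := hA
  obtain ⟨b, rfl⟩ := hB
  exact ⟨a + b, (embed_add a b).symm⟩

theorem ActsOn.conjTranspose {A : Op N} (hA : ActsOn W A) : ActsOn W Aᴴ := by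
  rw [actsOn_iff_exists_embed] at *
  obtain ⟨a, rfl⟩ := hA
  exact ⟨aᴴ, (embed_conjTranspose a).symm⟩

theorem ActsOn.smul {A : Op N} (c : ℂ) (hA : ActsOn W A) : ActsOn W (c • A) := by
  rw [actsOn_iff_exists_embed] at *
  obtain ⟨a, rfl⟩ := hA
  exact ⟨c • a, (embed_smul c a).symm⟩

theorem ActsOn.sum {ι : Type*} (s : Finset ι) {A : ι → Op N} (hA : ∀ i, ActsOn W (A i)) :
    ActsOn W (∑ i ∈ s, A i) := by
  simp only [actsOn_iff_exists_embed] at *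
  choose a ha using hA
  exact ⟨∑ i ∈ s, a i, by rw [embed_sum]; simp only [ha]⟩

open scoped Matrix.Norms.L2Operator in
theorem sum_norm_sq_col_le_norm_embed_sq (B : Matrix (W → Fin 2) (W → Fin 2) ℂ) (y : W → Fin 2) :
    ∑ x, ‖B x y‖ ^ 2 ≤ ‖embed W B‖ ^ 2 := by
  -- Any configuration outside `W` serves: column `y` of `B` reappears within column `(y, z)` of `B
  -- ⊗ 1`.
  let z : {i // i ∉ W} → Fin 2 := 0
  have h := sum_norm_sq_col_le_l2_opNorm_sq (embed W B) ((splitConf W).symm (y, z))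
  rw [← (splitConf W).symm.sum_comp, Fintype.sum_prod_type] at h
  refine le_trans (Finset.sum_le_sum fun x _ => ?_) h
  refine le_trans (le_of_eq ?_)
    (Finset.single_le_sum (fun w _ => by positivity) (Finset.mem_univ z))
  simp [embed]

open scoped Matrix.Norms.L2Operator in
/-- An operator on `W` is a combination of the unitaries `embed W (weyl w)`, with coefficients
bounded in `ℓ²` by its operator norm. -/
theorem ActsOn.exists_eq_sum_smul_embed_weyl {A : Op N} (hA : ActsOn W A) :
    ∃ o : (W → Fin 2) × AddChar (W → Fin 2) ℂ → ℂ,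
      A = ∑ w, o w • embed W (weyl w) ∧ ∑ w, ‖o w‖ ^ 2 ≤ ‖A‖ ^ 2 := by
  obtain ⟨B, rfl⟩ := actsOn_iff_exists_embed.mp hA
  obtain ⟨o, hB, ho⟩ := exists_eq_sum_smul_weyl B
  refine ⟨o, ?_, ?_⟩
  · conv_lhs => rw [hB]
    rw [embed_sum]
    simp only [embed_smul]
  -- The normalized Hilbert–Schmidt norm averages the squared column norms, each at most the squared
  -- operator norm.
  · rw [ho, Finset.sum_comm]
    have h : ∑ y, ∑ x, ‖B x y‖ ^ 2 ≤ ∑ _y : W → Fin 2, ‖embed W B‖ ^ 2 :=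
      Finset.sum_le_sum fun y _ => sum_norm_sq_col_le_norm_embed_sq B y
    rw [Finset.sum_const, Finset.card_univ, nsmul_eq_mul] at h
    rw [inv_mul_le_iff₀ (by exact_mod_cast Fintype.card_pos)]
    exact h

open scoped Matrix.Norms.L2Operator in
theorem norm_embed_weyl_le_one (w : (W → Fin 2) × AddChar (W → Fin 2) ℂ) :
    ‖embed W (weyl w)‖ ≤ 1 := by
  refine l2_opNorm_le_of_conjTranspose_mul_self _ zero_le_one ?_
  rw [← embed_conjTranspose, ← embed_mul, conjTranspose_weyl_mul_self, embed_one]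
  simp

end Embed

/-! ### Decoding from approximate Knill–Laflamme conditions -/

section Decoder

variable {N : ℕ}

theorem kronecker_one_mulVec {R : Type} [Fintype R] [DecidableEq R] (K : Op N)
    (Ψ : Matrix (Conf N) R ℂ) :
    ((K ⊗ₖ (1 : Matrix R R ℂ)) *ᵥ fun x => Ψ x.1 x.2) = fun x => (K * Ψ) x.1 x.2 := by
  ext ⟨q, r⟩
  simp only [mulVec, dotProduct, Fintype.sum_prod_type, kroneckerMap_apply, mul_apply]
  refine Finset.sum_congr rfl fun q' _ => ?_
  simp [one_apply]

theorem star_dotProduct_eq_trace {R : Type} [Fintype R] (Φ Ψ : Matrix (Conf N) R ℂ) :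
    (star fun x : Conf N × R => Φ x.1 x.2) ⬝ᵥ (fun x => Ψ x.1 x.2) = (Φᴴ * Ψ).trace := by
  simp only [dotProduct, Fintype.sum_prod_type, trace, diag_apply, mul_apply, Pi.star_apply,
    conjTranspose_apply]
  exact Finset.sum_comm

/-- A joint vector is stored as a system-by-reference matrix `Ψ`, so that `K ⊗ 1` becomes left
multiplication by `K`. Each pair of Kraus operators then contributes the squared modulus of one
amplitude. -/
theorem recoveryFidelity_eq_sum {m n : ℕ} {R : Type} [Fintype R] [DecidableEq R]
    (E : Fin m → Op N) (D : Fin n → Op N) (Ψ : Matrix (Conf N) R ℂ) :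
    recoveryFidelity E D (fun x => Ψ x.1 x.2)
      = ∑ b, ∑ a, ‖(Ψᴴ * (D b * (E a * Ψ))).trace‖ ^ 2 := by
  have hterm : ∀ (ψ : Conf N × R → ℂ) (M : Matrix (Conf N × R) (Conf N × R) ℂ),
      (star ψ ⬝ᵥ ((M * vecMulVec ψ (star ψ) * Mᴴ) *ᵥ ψ)).re = ‖star ψ ⬝ᵥ (M *ᵥ ψ)‖ ^ 2 := by
    intro ψ M
    rw [mul_vecMulVec, vecMulVec_mul, ← star_mulVec, vecMulVec_mulVec]
    simp only [dotProduct_smul, MulOpposite.smul_eq_mul_unop, MulOpposite.unop_op]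
    rw [show star (M *ᵥ ψ) ⬝ᵥ ψ = star (star ψ ⬝ᵥ (M *ᵥ ψ)) by rw [star_dotProduct]]
    have := Complex.mul_conj' (star ψ ⬝ᵥ (M *ᵥ ψ))
    rw [starRingEnd_apply] at this
    rw [this, ← Complex.ofReal_pow, Complex.ofReal_re]
  set ψ : Conf N × R → ℂ := fun x => Ψ x.1 x.2 with hψ
  have hexp : applyKraus D (applyKraus E (vecMulVec ψ (star ψ))) = ∑ b, ∑ a,
      ((D b ⊗ₖ (1 : Matrix R R ℂ)) * (E a ⊗ₖ (1 : Matrix R R ℂ))) * vecMulVec ψ (star ψ) *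
        ((D b ⊗ₖ (1 : Matrix R R ℂ)) * (E a ⊗ₖ (1 : Matrix R R ℂ)))ᴴ := by
    simp only [applyKraus, Finset.mul_sum, Finset.sum_mul, conjTranspose_mul, Matrix.mul_assoc]
  rw [recoveryFidelity, hexp]
  simp only [sum_mulVec, dotProduct_sum, Complex.re_sum, hterm]
  refine Finset.sum_congr rfl fun b _ => Finset.sum_congr rfl fun a _ => ?_
  rw [← mulVec_mulVec, hψ, kronecker_one_mulVec, kronecker_one_mulVec, star_dotProduct_eq_trace]

theorem norm_sum_star_mul_sq_le {ι : Type*} (s : Finset ι) (t g : ι → ℂ) :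
    ‖∑ i ∈ s, star (t i) * g i‖ ^ 2 ≤ (∑ i ∈ s, ‖t i‖ ^ 2) * ∑ i ∈ s, ‖g i‖ ^ 2 := by
  refine le_trans (pow_le_pow_left₀ (norm_nonneg _) (norm_sum_le _ _) 2) ?_
  simp only [norm_mul, norm_star]
  exact Finset.sum_mul_sq_le_sq_mul_sq _ _ _

theorem trace_conjTranspose_mul_self_eq_sum {m n : Type*} [Fintype m] [Fintype n]
    (A : Matrix m n ℂ) : (Aᴴ * A).trace = ((∑ j, ∑ i, ‖A i j‖ ^ 2 : ℝ) : ℂ) := by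
  simp only [trace, diag_apply, mul_apply, conjTranspose_apply]
  push_cast
  refine Finset.sum_congr rfl fun j _ => Finset.sum_congr rfl fun i _ => ?_
  exact Complex.conj_mul' _

theorem sum_comm_pairs {α β : Type*} [Fintype α] [Fintype β] (f : α → α → β → β → ℂ) :
    ∑ u, ∑ v, ∑ i, ∑ j, f u v i j = ∑ i, ∑ j, ∑ u, ∑ v, f u v i j := by
  have h1 : ∀ u, ∑ v, ∑ i, ∑ j, f u v i j = ∑ i, ∑ j, ∑ v, f u v i j := by
    intro u
    rw [Finset.sum_comm]
    exact Finset.sum_congr rfl fun i _ => Finset.sum_comm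
  simp only [h1]
  rw [Finset.sum_comm]
  exact Finset.sum_congr rfl fun i _ => Finset.sum_comm

variable {n m : ℕ}

/-- The operator that a test operator `S` on reference and environment induces on the system. -/
def pullback (E : Fin m → Op N) (B : Matrix (Fin n) (Fin n) ℂ)
    (S : Matrix (Fin n × Fin m) (Fin n × Fin m) ℂ) (i j : Fin n) : Op N :=
  ∑ u : Fin n × Fin m, ∑ v : Fin n × Fin m,
    (star (B i u.1) * B j v.1 * S v u) • ((E u.2)ᴴ * E v.2)

open scoped Matrix.Norms.L2Operator in
-- The pullback factors as `(X i)ᴴ (1 ⊗ Sᵀ) (X j)`, where `X i` stacks the blocks `B i r • E a`. The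
-- Kraus condition makes `X i` a multiple of an isometry, so the bound does not depend on the number
-- `m` of Kraus operators.
theorem norm_pullback_le {E : Fin m → Op N} (hE : IsKraus E) (B : Matrix (Fin n) (Fin n) ℂ)
    {S : Matrix (Fin n × Fin m) (Fin n × Fin m) ℂ} (hS : Sᴴ * S = 1) (i j : Fin n) :
    ‖pullback E B S i j‖ ≤ √(∑ r, ‖B i r‖ ^ 2) * √(∑ r, ‖B j r‖ ^ 2) := by
  let X : Fin n → Matrix (Conf N × (Fin n × Fin m)) (Conf N) ℂ := fun i =>
    Matrix.of fun x q => B i x.2.1 * E x.2.2 x.1 q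
  have hX : ∀ i, ‖X i‖ ≤ √(∑ r, ‖B i r‖ ^ 2) := by
    intro i
    refine l2_opNorm_le_of_conjTranspose_mul_self _ (Real.sqrt_nonneg _) ?_
    rw [Real.sq_sqrt (by positivity), ← hE]
    ext q q'
    simp only [X, mul_apply, conjTranspose_apply, of_apply, Fintype.sum_prod_type,
      Matrix.smul_apply, Matrix.sum_apply, smul_eq_mul]
    rw [Finset.sum_comm]
    push_cast
    rw [Finset.sum_mul]
    refine Finset.sum_congr rfl fun r _ => ?_
    rw [Finset.sum_comm, Finset.mul_sum]
    refine Finset.sum_congr rfl fun a _ => ?_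
    rw [Finset.mul_sum]
    refine Finset.sum_congr rfl fun p _ => ?_
    rw [← Complex.conj_mul', starRingEnd_apply, star_mul]
    ring
  have hS' : (Sᵀ)ᴴ * Sᵀ = 1 := by
    have h : S * Sᴴ = 1 := mul_eq_one_comm.mp hS
    have := congrArg Matrix.transpose h
    rwa [transpose_mul, transpose_one] at this
  have hT : ‖(1 : Op N) ⊗ₖ Sᵀ‖ ≤ 1 := by
    by_cases hne : Nonempty (Fin n × Fin m)
    · refine l2_opNorm_le_of_conjTranspose_mul_self _ zero_le_one ?_
      rw [conjTranspose_kronecker, ← mul_kronecker_mul, hS', conjTranspose_one, mul_one,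
        one_kronecker_one]
      simp
    · have : (1 : Op N) ⊗ₖ Sᵀ = 0 := by
        ext x y
        exact (hne ⟨x.2⟩).elim
      rw [this, norm_zero]
      exact zero_le_one
  have heq : pullback E B S i j = (X i)ᴴ * (((1 : Op N) ⊗ₖ Sᵀ) * X j) := by
    ext q q'
    have h1 : ∀ p u, (((1 : Op N) ⊗ₖ Sᵀ) * X j) (p, u) q'
        = ∑ v, S v u * (B j v.1 * E v.2 p q') := by
      intro p u
      simp only [mul_apply, X, of_apply, kroneckerMap_apply, transpose_apply,
        Fintype.sum_prod_type (α₁ := Conf N)]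
      rw [Finset.sum_eq_single p]
      · simp
      · intro b _ hb
        simp [one_apply_ne hb.symm]
      · simp
    rw [mul_apply, Fintype.sum_prod_type]
    simp only [h1, conjTranspose_apply, X, of_apply]
    simp only [pullback, Matrix.sum_apply, Matrix.smul_apply, mul_apply, conjTranspose_apply,
      smul_eq_mul, Finset.mul_sum]
    conv_rhs => rw [Finset.sum_comm]
    refine Finset.sum_congr rfl fun u _ => ?_
    conv_rhs => rw [Finset.sum_comm]
    refine Finset.sum_congr rfl fun v _ => Finset.sum_congr rfl fun p _ => ?_
    rw [star_mul]
    ring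
  calc ‖pullback E B S i j‖ ≤ ‖X i‖ * (‖(1 : Op N) ⊗ₖ Sᵀ‖ * ‖X j‖) := by
        rw [heq, ← l2_opNorm_conjTranspose (X i)]
        exact (l2_opNorm_mul _ _).trans
          (mul_le_mul_of_nonneg_left (l2_opNorm_mul _ _) (norm_nonneg _))
    _ ≤ √(∑ r, ‖B i r‖ ^ 2) * (1 * √(∑ r, ‖B j r‖ ^ 2)) := by
        gcongr
        · exact hX i
        · exact hX j
    _ = _ := by rw [one_mul]

/-- Deviation of the matrix of `O` in the code basis `V` from a multiple of the identity. -/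
def deviation (V : Matrix (Conf N) (Fin n) ℂ) (i j : Fin n) : Op N →ₗ[ℂ] ℂ where
  toFun O := (Vᴴ * O * V) i j - if i = j then (n : ℂ)⁻¹ * (Vᴴ * O * V).trace else 0
  map_add' A B := by
    simp only [Matrix.mul_add, Matrix.add_mul, Matrix.add_apply, trace_add]
    split_ifs <;> ring
  map_smul' c A := by
    simp only [Matrix.mul_smul, Matrix.smul_mul, Matrix.smul_apply, trace_smul, smul_eq_mul,
      RingHom.id_apply]
    split_ifs <;> ring

/-- The constant `l` need not depend linearly on `O`, whereas the normalized trace does. That trace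
is itself within `r` of `l`, hence the factor 2. -/
theorem norm_deviation_le (V : Matrix (Conf N) (Fin n) ℂ) (O : Op N) {l : ℂ} {r : ℝ}
    (h : ∀ i j, ‖(Vᴴ * O * V) i j - if i = j then l else 0‖ ≤ r) (i j : Fin n) :
    ‖deviation V i j O‖ ≤ 2 * r := by
  have hr : 0 ≤ r := (norm_nonneg _).trans (h i i)
  have hn : (n : ℂ) ≠ 0 := by
    have := i.pos
    exact_mod_cast this.ne'
  have hij := h i j
  change ‖(Vᴴ * O * V) i j - if i = j then (n : ℂ)⁻¹ * (Vᴴ * O * V).trace else 0‖ ≤ _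
  split_ifs at hij ⊢ with e
  · have h1 : (Vᴴ * O * V) i j - (n : ℂ)⁻¹ * (Vᴴ * O * V).trace
        = ((Vᴴ * O * V) i j - l) - (n : ℂ)⁻¹ * ∑ k, ((Vᴴ * O * V) k k - l) := by
      rw [Finset.sum_sub_distrib, Finset.sum_const, Finset.card_univ, Fintype.card_fin,
        nsmul_eq_mul, mul_sub, inv_mul_cancel_left₀ hn, trace]
      simp only [diag_apply]
      ring
    have h2 : ‖∑ k, ((Vᴴ * O * V) k k - l)‖ ≤ n * r := by
      refine (norm_sum_le_of_le _ (fun k _ => by simpa using h k k)).trans ?_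
      simp
    have h3 : ‖(n : ℂ)⁻¹ * ∑ k, ((Vᴴ * O * V) k k - l)‖ ≤ r := by
      rw [norm_mul, norm_inv, Complex.norm_natCast, inv_mul_le_iff₀ (by exact_mod_cast i.pos)]
      exact h2
    rw [h1]
    linarith [norm_sub_le ((Vᴴ * O * V) i j - l) ((n : ℂ)⁻¹ * ∑ k, ((Vᴴ * O * V) k k - l))]
  · linarith

open scoped Matrix.Norms.L2Operator ComplexOrder in
/-- If all operators on `W` are, in the code basis `V`, close to multiples of the identity, then
noise on `W` can be corrected on the code. -/
theorem exists_decoder {W : Finset (Fin N)} (hn : 0 < n) (V : Matrix (Conf N) (Fin n) ℂ)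
    (hV : Vᴴ * V = 1) {κ : ℝ} (hκ : 0 ≤ κ)
    (hKL : ∀ O : Op N, ActsOn W O →
      ∃ l : ℂ, ∀ i j, ‖(Vᴴ * O * V) i j - if i = j then l else 0‖ ≤ κ * ‖O‖)
    (E : Fin m → Op N) (hE : IsKraus E) (hEW : ∀ a, ActsOn W (E a))
    (B : Matrix (Fin n) (Fin n) ℂ) (hB : (Bᴴ * B).trace = 1) :
    ∃ D : Fin m → Op N, IsKraus D ∧
      1 - 2 * κ * n ≤ recoveryFidelity E D (fun x => (V * B) x.1 x.2) := by
  have hn0 : (n : ℂ) ≠ 0 := by exact_mod_cast hn.ne'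
  set Ψ := V * B with hΨ
  have hΨΨ : Ψᴴ * Ψ = Bᴴ * B := by
    rw [hΨ, conjTranspose_mul, Matrix.mul_assoc, ← Matrix.mul_assoc Vᴴ, hV, Matrix.one_mul]
  let L : Matrix (Conf N × Fin n) (Fin m) ℂ := Matrix.of fun x a => (E a * V) x.1 x.2
  -- The environment state produced by the maximally mixed code state; exact Knill–Laflamme would
  -- make it the environment state of every code state.
  let Λ : Matrix (Fin m) (Fin m) ℂ := ((n : ℝ)⁻¹ : ℂ) • (Lᴴ * L)
  have hΛ : ∀ a b, Λ a b = (n : ℂ)⁻¹ * (Vᴴ * ((E a)ᴴ * E b) * V).trace := by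
    intro a b
    have : Vᴴ * ((E a)ᴴ * E b) * V = (E a * V)ᴴ * (E b * V) := by
      simp only [conjTranspose_mul, Matrix.mul_assoc]
    rw [this, ← star_dotProduct_eq_trace]
    simp [Λ, L, mul_apply, dotProduct]
  have hΛp : Λ.PosSemidef :=
    (posSemidef_conjTranspose_mul_self L).smul (by positivity)
  obtain ⟨T, hTp, hT⟩ := exists_posSemidef_mul_self_eq hΛp
  have hsum : ∀ C : Matrix (Conf N) (Fin n) ℂ,
      ∑ a, (Cᴴ * ((E a)ᴴ * E a) * C).trace = (Cᴴ * C).trace := by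
    intro C
    rw [← trace_sum, ← Matrix.sum_mul, ← Matrix.mul_sum, hE, Matrix.mul_one]
  have hTtr : (Tᴴ * T).trace = 1 := by
    rw [hTp.1, hT, trace]
    simp only [diag_apply, hΛ]
    rw [← Finset.mul_sum, hsum, hV, trace_one, Fintype.card_fin, inv_mul_cancel₀ hn0]
  -- The Gram matrix of `X` is the true joint state of reference and environment; that of `Y` is the
  -- ideal uncorrelated one, with `Y` purified by the undamaged `Ψ` and by `T`.
  let X : Matrix (Conf N) (Fin n × Fin m) ℂ := Matrix.of fun q u => (E u.2 * Ψ) q u.1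
  let Y : Matrix (Conf N × Fin m) (Fin n × Fin m) ℂ := Ψ ⊗ₖ T
  have hXX : ∀ u v, (Xᴴ * X) u v = (Bᴴ * (Vᴴ * ((E u.2)ᴴ * E v.2) * V) * B) u.1 v.1 := by
    intro u v
    have : Bᴴ * (Vᴴ * ((E u.2)ᴴ * E v.2) * V) * B = (E u.2 * Ψ)ᴴ * (E v.2 * Ψ) := by
      simp only [hΨ, conjTranspose_mul, Matrix.mul_assoc]
    rw [this, mul_apply, mul_apply]
    rfl
  have hYY : ∀ u v, (Yᴴ * Y) u v
      = (Bᴴ * (Λ u.2 v.2 • (1 : Matrix (Fin n) (Fin n) ℂ)) * B) u.1 v.1 := by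
    intro u v
    rw [conjTranspose_kronecker, ← mul_kronecker_mul, hΨΨ, hTp.1, hT, kroneckerMap_apply]
    simp [mul_comm]
  have hXtr : (Xᴴ * X).trace = 1 := by
    rw [trace, Fintype.sum_prod_type, Finset.sum_comm]
    simp only [diag_apply, hXX]
    calc _ = ∑ a, (Ψᴴ * ((E a)ᴴ * E a) * Ψ).trace := by
          refine Finset.sum_congr rfl fun a _ => ?_
          simp only [hΨ, conjTranspose_mul, Matrix.mul_assoc, trace, diag_apply]
      _ = 1 := by rw [hsum, hΨΨ, hB]
  have hYtr : (Yᴴ * Y).trace = 1 := by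
    rw [conjTranspose_kronecker, ← mul_kronecker_mul, trace_kronecker, hΨΨ, hB, hTtr, one_mul]
  have hbound : ∀ S : Matrix (Fin n × Fin m) (Fin n × Fin m) ℂ, Sᴴ * S = 1 →
      ‖((Xᴴ * X - Yᴴ * Y) * S).trace‖ ≤ 2 * κ * n := by
    intro S hS
    have hentry : ∀ u v, (Xᴴ * X - Yᴴ * Y) u v = ∑ i, ∑ j, star (B i u.1) *
        deviation V i j ((E u.2)ᴴ * E v.2) * B j v.1 := by
      intro u v
      rw [Matrix.sub_apply, hXX, hYY, ← Matrix.sub_apply, ← Matrix.sub_mul, ← Matrix.mul_sub,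
        mul_apply, Finset.sum_comm]
      refine Finset.sum_congr rfl fun j _ => ?_
      rw [mul_apply, Finset.sum_mul]
      refine Finset.sum_congr rfl fun i _ => ?_
      rw [conjTranspose_apply, Matrix.sub_apply, Matrix.smul_apply, hΛ, one_apply]
      simp [deviation]
    -- Collecting all Kraus pairs into one operator on `W` before using `hKL` avoids a loss in `m`.
    have hrew : ((Xᴴ * X - Yᴴ * Y) * S).trace
        = ∑ i, ∑ j, deviation V i j (pullback E B S i j) := by
      simp only [trace, diag_apply, mul_apply (M := Xᴴ * X - Yᴴ * Y), hentry, pullback, map_sum,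
        map_smul, smul_eq_mul, Finset.sum_mul]
      rw [sum_comm_pairs]
      refine Finset.sum_congr rfl fun i _ => Finset.sum_congr rfl fun j _ =>
        Finset.sum_congr rfl fun u _ => Finset.sum_congr rfl fun v _ => ?_
      ring
    have hpb : ∀ i j, ‖deviation V i j (pullback E B S i j)‖
        ≤ 2 * κ * (√(∑ r, ‖B i r‖ ^ 2) * √(∑ r, ‖B j r‖ ^ 2)) := by
      intro i j
      obtain ⟨l, hl⟩ := hKL (pullback E B S i j) (ActsOn.sum _ fun u => ActsOn.sum _ fun v =>
        ((hEW u.2).conjTranspose.mul (hEW v.2)).smul _)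
      refine (norm_deviation_le V _ hl i j).trans ?_
      rw [mul_assoc]
      have := norm_pullback_le hE B hS i j
      gcongr
    have hβ : ∑ i, (√(∑ r, ‖B i r‖ ^ 2)) ^ 2 = 1 := by
      have h := trace_conjTranspose_mul_self_eq_sum B
      rw [hB] at h
      have h' : ∑ r, ∑ i, ‖B i r‖ ^ 2 = 1 := by exact_mod_cast h.symm
      rw [Finset.sum_comm] at h'
      rw [← h']
      exact Finset.sum_congr rfl fun i _ => Real.sq_sqrt (by positivity)
    rw [hrew]
    calc ‖∑ i, ∑ j, deviation V i j (pullback E B S i j)‖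
        ≤ ∑ i, ∑ j, 2 * κ * (√(∑ r, ‖B i r‖ ^ 2) * √(∑ r, ‖B j r‖ ^ 2)) :=
          norm_sum_le_of_le _ fun i _ => norm_sum_le_of_le _ fun j _ => hpb i j
      _ = 2 * κ * (∑ i, √(∑ r, ‖B i r‖ ^ 2)) ^ 2 := by
          rw [sq, Finset.sum_mul_sum, Finset.mul_sum]
          simp only [Finset.mul_sum]
      _ ≤ 2 * κ * (n * 1) := by
          -- The rows of `B` have squared norms summing to 1, so Cauchy–Schwarz costs only a factor
          -- `n`.
          have h := sq_sum_le_card_mul_sum_sq (s := Finset.univ)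
            (f := fun i => √(∑ r, ‖B i r‖ ^ 2))
          rw [hβ, Finset.card_univ, Fintype.card_fin] at h
          gcongr
      _ = 2 * κ * n := by rw [mul_one]
  have hm : 0 < m := by
    rcases Nat.eq_zero_or_pos m with rfl | h
    · exact absurd hE (by simp [IsKraus])
    · exact h
  have hnN : n ≤ Fintype.card (Conf N) := by
    have h1 := rank_le_card_height V
    have h2 : (Vᴴ * V).rank ≤ V.rank := rank_mul_le_right _ _
    rw [hV, rank_one, Fintype.card_fin] at h2
    exact h2.trans h1
  obtain ⟨U, hU, hov⟩ := exists_isometry_overlap_ge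
    (by rw [Fintype.card_prod, Fintype.card_fin]; exact Nat.le_mul_of_pos_right _ hm)
    (by
      rw [Fintype.card_prod, Fintype.card_prod, Fintype.card_fin, Fintype.card_fin]
      exact Nat.mul_le_mul_right _ hnN) X Y hXtr hYtr hbound
  -- The isometry `U` is read as a Stinespring dilation of the decoder; its blocks are the Kraus
  -- operators.
  let D : Fin m → Op N := fun b => Matrix.of fun q q' => U (q, b) q'
  refine ⟨D, ?_, ?_⟩
  · rw [IsKraus, ← hU]
    ext q q'
    simp only [Matrix.sum_apply, mul_apply, conjTranspose_apply, D, of_apply,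
      Fintype.sum_prod_type]
    exact Finset.sum_comm
  · rw [recoveryFidelity_eq_sum]
    have htr : (Yᴴ * (U * X)).trace
        = ∑ w : Fin m × Fin m, star (T w.1 w.2) * (Ψᴴ * (D w.1 * (E w.2 * Ψ))).trace := by
      have hUX : ∀ q b r a, (U * X) (q, b) (r, a) = (D b * (E a * Ψ)) q r := by
        intro q b r a
        rw [mul_apply, mul_apply]
        rfl
      simp only [trace, diag_apply, mul_apply (M := Yᴴ), mul_apply (M := Ψᴴ), Fintype.sum_prod_type,
        conjTranspose_apply, hUX, Y, kroneckerMap_apply, Finset.mul_sum]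
      rw [Finset.sum_comm]
      conv_rhs => rw [Finset.sum_comm]
      refine Finset.sum_congr rfl fun a _ => ?_
      conv_rhs => rw [Finset.sum_comm]
      refine Finset.sum_congr rfl fun r _ => ?_
      rw [Finset.sum_comm]
      refine Finset.sum_congr rfl fun b _ => Finset.sum_congr rfl fun q _ => ?_
      rw [star_mul]
      ring
    -- As `T` has Hilbert–Schmidt norm 1, the fidelity is at least the squared overlap.
    have hcs := norm_sum_star_mul_sq_le Finset.univ (fun w : Fin m × Fin m => T w.1 w.2)
      (fun w => (Ψᴴ * (D w.1 * (E w.2 * Ψ))).trace)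
    rw [← htr, Fintype.sum_prod_type, Fintype.sum_prod_type] at hcs
    have hT1 : ∑ b, ∑ a, ‖T b a‖ ^ 2 = 1 := by
      have h := trace_conjTranspose_mul_self_eq_sum T
      rw [hTtr] at h
      have h' : ∑ a, ∑ b, ‖T b a‖ ^ 2 = 1 := by exact_mod_cast h.symm
      rwa [Finset.sum_comm] at h'
    simp only [hT1, one_mul] at hcs
    refine le_trans ?_ hcs
    have := Complex.abs_re_le_norm (Yᴴ * (U * X)).trace
    have h1 := le_abs_self (Yᴴ * (U * X)).trace.re
    -- The overlap `x` satisfies `x ≥ 1 - κ * n`, and `x ^ 2 ≥ 2 * x - 1` needs no sign condition.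
    nlinarith [sq_nonneg (‖(Yᴴ * (U * X)).trace‖ - 1)]

end Decoder

/-! ### Codes spanned by orthonormal families, and the windows of the chain. -/

theorem of_conjTranspose_mul_mul_apply {N n : ℕ} (φ : Fin n → Ket N) (O : Op N) (i j : Fin n) :
    ((Matrix.of fun q i => φ i q : Matrix (Conf N) (Fin n) ℂ)ᴴ * O *
      (Matrix.of fun q i => φ i q : Matrix (Conf N) (Fin n) ℂ)) i j = star (φ i) ⬝ᵥ (O *ᵥ φ j) := by
  rw [Matrix.mul_assoc, mul_apply]
  simp only [dotProduct, mulVec, mul_apply, conjTranspose_apply, of_apply, Pi.star_apply]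

open scoped Matrix.Norms.L2Operator in
/-- Approximate Knill–Laflamme conditions for all windows give an approximate code. -/
theorem isAQECC_of_approx_knillLaflamme {N k d : ℕ} {κ ε : ℝ} (φ : Fin (2 ^ k) → Ket N)
    (horth : ∀ i j, star (φ i) ⬝ᵥ φ j = if i = j then 1 else 0) (hκ : 0 ≤ κ)
    (hKL : ∀ a, ∀ O : Op N, ActsOn (window N a d) O →
      ∃ l : ℂ, ∀ i j, ‖star (φ i) ⬝ᵥ (O *ᵥ φ j) - if i = j then l else 0‖ ≤ κ * ‖O‖)
    (hε : 2 * κ * 2 ^ k ≤ ε) : IsAQECC k d ε (Submodule.span ℂ (Set.range φ)) := by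
  set V : Matrix (Conf N) (Fin (2 ^ k)) ℂ := Matrix.of fun q i => φ i q with hVdef
  have hV : Vᴴ * V = 1 := by
    ext i j
    rw [one_apply, ← horth i j]
    have := of_conjTranspose_mul_mul_apply φ 1 i j
    rwa [Matrix.mul_one, one_mulVec] at this
  refine ⟨?_, ?_⟩
  · have hli : LinearIndependent ℂ φ := by
      rw [Fintype.linearIndependent_iff]
      intro g hg i
      have h : star (φ i) ⬝ᵥ (∑ j, g j • φ j) = 0 := by rw [hg, dotProduct_zero]
      rw [dotProduct_sum] at h
      simpa [dotProduct_smul, horth] using h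
    rw [finrank_span_eq_card hli, Fintype.card_fin]
  · intro a m E hE hEW ψ hψ hnorm
    have hmem : ∀ r, ∃ b : Fin (2 ^ k) → ℂ, ∑ i, b i • φ i = fun q => ψ (q, r) :=
      fun r => (Submodule.mem_span_range_iff_exists_fun ℂ).mp (hψ r)
    choose b hb using hmem
    let B : Matrix (Fin (2 ^ k)) (Fin (2 ^ k)) ℂ := Matrix.of fun i r => b r i
    have hψB : ψ = fun x => (V * B) x.1 x.2 := by
      ext ⟨q, r⟩
      rw [← congrFun (hb r) q, mul_apply]
      simp [V, B, mul_comm]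
    have hB : (Bᴴ * B).trace = 1 := by
      rw [hψB, star_dotProduct_eq_trace, conjTranspose_mul, Matrix.mul_assoc,
        ← Matrix.mul_assoc Vᴴ, hV, Matrix.one_mul] at hnorm
      exact hnorm
    obtain ⟨D, hD, hfid⟩ := exists_decoder (by positivity) V hV hκ
      (fun O hO => by simpa only [hVdef, of_conjTranspose_mul_mul_apply] using hKL a O hO)
      E hE hEW B hB
    refine ⟨m, D, hD, ?_⟩
    rw [hψB]
    refine le_trans ?_ hfid
    push_cast
    linarith

theorem card_window_le (N a d : ℕ) : (window N a d).card ≤ d := by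
  have h : ((window N a d).map Fin.valEmbedding) ⊆ Finset.Ico a (a + d) := by
    intro i hi
    simp only [window, Finset.mem_map, Finset.mem_filter, Finset.mem_univ, true_and] at hi
    obtain ⟨j, hj, rfl⟩ := hi
    exact Finset.mem_Ico.mpr hj
  simpa using Finset.card_le_card h

/-- Every start at or beyond `N` gives the empty window, so `N + 1` starts represent all of them. -/
theorem window_min_eq (N a d : ℕ) : window N (min a N) d = window N a d := by
  ext i
  have := i.2
  simp only [window, Finset.mem_filter, Finset.mem_univ, true_and]
  omega

/-! ### Concentration of the matrix elements -/

section Probability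

open MeasureTheory

variable {N d n : ℕ} {Ω : Type*} [MeasurableSpace Ω] {μ : Measure Ω} {β c E : ℝ} {S : Ω → ℝ}
  {e : Ω → Fin n → ℝ} {ψ : Ω → Fin n → Ket N}

/-- The envelope gives `|f| ≤ c` at every gap, leaving `‖R‖ ^ 2` as the random factor. The random
energies thus drop out, and no joint law of energies and `R` is needed. -/
theorem SatisfiesETH.exists_norm_sq_le {A : Op N} (hβ : 0 < β)
    (h : SatisfiesETH μ β c E S e ψ A) :
    ∃ (l : ℂ) (Z : Fin n → Fin n → Ω → ℝ), (∀ i j, Integrable (Z i j) μ) ∧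
      (∀ i j x, 0 ≤ Z i j x) ∧ (∀ i j, ∫ x, Z i j x ∂μ = 1) ∧
      ∀ᵐ x ∂μ, ∀ i j, ‖star (ψ x i) ⬝ᵥ (A *ᵥ ψ x j) - if i = j then l else 0‖ ^ 2
        ≤ c ^ 2 * Real.exp (-S x) * Z i j x := by
  obtain ⟨avg, f, R, -, -, hf, hR, hae⟩ := h
  refine ⟨avg E, fun i j x => ‖R i j x‖ ^ 2,
    fun i j => (memLp_two_iff_integrable_sq_norm (hR i j).1.1).mp (hR i j).1,
    fun i j x => by positivity, fun i j => (hR i j).2.2, ?_⟩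
  filter_upwards [hae] with x hx i j
  rw [hx i j, add_sub_cancel_left, norm_mul, Complex.norm_real, Real.norm_eq_abs, abs_mul,
    Real.abs_exp, mul_pow, mul_pow]
  have h1 : Real.exp (-S x / 2) ^ 2 = Real.exp (-S x) := by
    rw [← Real.exp_nat_mul]; congr 1; push_cast; ring
  have hc : 0 ≤ c := by simpa using (abs_nonneg _).trans (hf 0)
  have h2 : |f E (e x i - e x j)| ≤ c := by
    refine (hf _).trans (mul_le_of_le_one_right hc (Real.exp_le_one_iff.mpr ?_))
    have := mul_nonneg (by positivity : 0 ≤ β / 4) (abs_nonneg (e x i - e x j))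
    linarith
  have h3 := pow_le_pow_left₀ (abs_nonneg _) h2 2
  rw [h1, mul_comm (c ^ 2)]
  gcongr

open scoped Matrix.Norms.L2Operator in
/-- For local operators that need not be Hermitian, the ansatz bounds the second moment of the
fluctuations of the matrix elements. -/
theorem exists_fluctuation_bound (hβ : 0 < β)
    (hETH : ∀ A : Op N, IsLocalObservable d A → SatisfiesETH μ β c E S e ψ A)
    {a : ℕ} {O : Op N} (hO : ActsOn (window N a d) O) (hO1 : ‖O‖ ≤ 1) :
    ∃ (l : ℂ) (Z : Ω → ℝ), Integrable Z μ ∧ (∀ x, 0 ≤ Z x) ∧ ∫ x, Z x ∂μ = 4 * n ^ 2 ∧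
      ∀ᵐ x ∂μ, ∀ i j, ‖star (ψ x i) ⬝ᵥ (O *ᵥ ψ x j) - if i = j then l else 0‖ ^ 2
        ≤ c ^ 2 * Real.exp (-S x) * Z x := by
  -- The ansatz covers only Hermitian observables, so it is applied to the real and imaginary parts
  -- of `O`.
  set A₁ : Op N := (2⁻¹ : ℂ) • (O + Oᴴ)
  set A₂ : Op N := (2⁻¹ * Complex.I : ℂ) • (Oᴴ + (-1 : ℂ) • O)
  have hsum : O = A₁ + Complex.I • A₂ := by
    ext x y
    simp only [A₁, A₂, Matrix.add_apply, Matrix.smul_apply, smul_eq_mul]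
    linear_combination (-(1 : ℂ) / 2 * Oᴴ x y + 1 / 2 * O x y) * Complex.I_mul_I
  have hn : ∀ (z : ℂ) (P Q : Op N), ‖z‖ = 2⁻¹ → ‖P‖ ≤ 1 → ‖Q‖ ≤ 1 → ‖z • (P + Q)‖ ≤ 1 := by
    intro z P Q hz hP hQ
    rw [norm_smul, hz]
    linarith [norm_add_le P Q]
  have hO1' : ‖Oᴴ‖ ≤ 1 := by rwa [l2_opNorm_conjTranspose]
  have h₁ : IsLocalObservable d A₁ := by
    refine ⟨?_, ⟨a, (hO.add hO.conjTranspose).smul _⟩, hn _ _ _ (by simp) hO1 hO1'⟩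
    simp [IsHermitian, A₁, conjTranspose_smul, add_comm]
  have h₂ : IsLocalObservable d A₂ := by
    refine ⟨?_, ⟨a, (hO.conjTranspose.add (hO.smul _)).smul _⟩,
      hn _ _ _ (by simp) hO1' (by rwa [norm_smul, norm_neg, norm_one, one_mul])⟩
    ext x y
    simp [A₂, conjTranspose_apply]
    ring
  obtain ⟨l₁, Z₁, hi₁, hp₁, hm₁, hb₁⟩ := (hETH A₁ h₁).exists_norm_sq_le hβ
  obtain ⟨l₂, Z₂, hi₂, hp₂, hm₂, hb₂⟩ := (hETH A₂ h₂).exists_norm_sq_le hβ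
  have hint : ∀ i j, Integrable (fun x => 2 * (Z₁ i j x + Z₂ i j x)) μ :=
    fun i j => ((hi₁ i j).add (hi₂ i j)).const_mul 2
  have hpos : ∀ i j x, 0 ≤ 2 * (Z₁ i j x + Z₂ i j x) := fun i j x => by
    have := hp₁ i j x
    have := hp₂ i j x
    positivity
  -- The outer 2 comes from `(u + v)² ≤ 2 * (u² + v²)`. Each of the `n ^ 2` entries then has mean 4.
  refine ⟨l₁ + Complex.I * l₂, fun x => ∑ i, ∑ j, 2 * (Z₁ i j x + Z₂ i j x),
    integrable_finsetSum _ fun i _ => integrable_finsetSum _ fun j _ => hint i j,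
    fun x => Finset.sum_nonneg fun i _ => Finset.sum_nonneg fun j _ => hpos i j x, ?_, ?_⟩
  · rw [integral_finsetSum _ fun i _ => integrable_finsetSum _ fun j _ => hint i j]
    have : ∀ i, ∫ x, ∑ j, 2 * (Z₁ i j x + Z₂ i j x) ∂μ = n * 4 := by
      intro i
      rw [integral_finsetSum _ fun j _ => hint i j]
      have : ∀ j, ∫ x, 2 * (Z₁ i j x + Z₂ i j x) ∂μ = 4 := by
        intro j
        rw [integral_const_mul, integral_add (hi₁ i j) (hi₂ i j), hm₁, hm₂]
        norm_num
      simp [this]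
    simp only [this, Finset.sum_const, Finset.card_univ, Fintype.card_fin, nsmul_eq_mul]
    ring
  · filter_upwards [hb₁, hb₂] with x hx₁ hx₂ i j
    have hdev : star (ψ x i) ⬝ᵥ (O *ᵥ ψ x j) - (if i = j then l₁ + Complex.I * l₂ else 0)
        = (star (ψ x i) ⬝ᵥ (A₁ *ᵥ ψ x j) - if i = j then l₁ else 0) +
          Complex.I * (star (ψ x i) ⬝ᵥ (A₂ *ᵥ ψ x j) - if i = j then l₂ else 0) := by
      have hO : O *ᵥ ψ x j = A₁ *ᵥ ψ x j + Complex.I • (A₂ *ᵥ ψ x j) := by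
        rw [← smul_mulVec, ← add_mulVec, ← hsum]
      rw [hO, dotProduct_add, dotProduct_smul, smul_eq_mul]
      split_ifs <;> ring
    have hle : 2 * (Z₁ i j x + Z₂ i j x) ≤ ∑ i, ∑ j, 2 * (Z₁ i j x + Z₂ i j x) :=
      (Finset.single_le_sum (fun j _ => hpos i j x) (Finset.mem_univ j)).trans
        (Finset.single_le_sum (f := fun i => ∑ j, 2 * (Z₁ i j x + Z₂ i j x))
          (fun i _ => Finset.sum_nonneg fun j _ => hpos i j x) (Finset.mem_univ i))
    have hle' := mul_le_mul_of_nonneg_left hle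
      (by positivity : 0 ≤ c ^ 2 * Real.exp (-S x))
    refine le_trans ?_ hle'
    rw [hdev]
    set u := star (ψ x i) ⬝ᵥ (A₁ *ᵥ ψ x j) - if i = j then l₁ else 0
    set v := star (ψ x i) ⬝ᵥ (A₂ *ᵥ ψ x j) - if i = j then l₂ else 0
    have h1 : ‖u‖ ^ 2 ≤ _ := hx₁ i j
    have h2 : ‖v‖ ^ 2 ≤ _ := hx₂ i j
    have h3 : ‖u + Complex.I * v‖ ≤ ‖u‖ + ‖v‖ := by
      refine (norm_add_le _ _).trans ?_
      rw [norm_mul, Complex.norm_I, one_mul]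
    have h4 := pow_le_pow_left₀ (norm_nonneg _) h3 2
    nlinarith [sq_nonneg (‖u‖ - ‖v‖)]

open scoped Matrix.Norms.L2Operator in
/-- The ansatz implies approximate Knill–Laflamme conditions for all operators on all windows of
length `d`, with a single random variable of bounded mean controlling the violation. -/
theorem exists_uniform_fluctuation_bound (hβ : 0 < β) (hc : 0 ≤ c)
    (hETH : ∀ A : Op N, IsLocalObservable d A → SatisfiesETH μ β c E S e ψ A) :
    ∃ Z : Ω → ℝ, Integrable Z μ ∧ (∀ x, 0 ≤ Z x) ∧
      ∫ x, Z x ∂μ ≤ (N + 1) * 4 ^ d * (4 * n ^ 2) ∧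
      ∀ᵐ x ∂μ, ∀ a, ∀ O : Op N, ActsOn (window N a d) O → ∃ l : ℂ, ∀ i j,
        ‖star (ψ x i) ⬝ᵥ (O *ᵥ ψ x j) - if i = j then l else 0‖
          ≤ c * Real.exp (-S x / 2) * √(Z x) * ‖O‖ := by
  choose l Z hint hpos hmean hbd using fun (a : Fin (N + 1))
      (w : (window N a d → Fin 2) × AddChar (window N a d → Fin 2) ℂ) =>
    exists_fluctuation_bound hβ hETH (actsOn_iff_exists_embed.mpr ⟨weyl w, rfl⟩)
      (norm_embed_weyl_le_one w)
  refine ⟨fun x => ∑ a, ∑ w, Z a w x,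
    integrable_finsetSum _ fun a _ => integrable_finsetSum _ fun w _ => hint a w,
    fun x => Finset.sum_nonneg fun a _ => Finset.sum_nonneg fun w _ => hpos a w x, ?_, ?_⟩
  · rw [integral_finsetSum _ fun a _ => integrable_finsetSum _ fun w _ => hint a w]
    have h : ∀ a : Fin (N + 1), ∫ x, ∑ w, Z a w x ∂μ ≤ 4 ^ d * (4 * n ^ 2) := by
      intro a
      rw [integral_finsetSum _ fun w _ => hint a w]
      simp only [hmean, Finset.sum_const, Finset.card_univ, nsmul_eq_mul]
      gcongr
      rw [Fintype.card_prod, AddChar.card_eq]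
      simp only [Fintype.card_fun, Fintype.card_fin, Fintype.card_coe]
      have h2 : 2 ^ (window N a d).card ≤ 2 ^ d :=
        Nat.pow_le_pow_right two_pos (card_window_le N a d)
      calc ((2 ^ (window N a d).card * 2 ^ (window N a d).card : ℕ) : ℝ)
          ≤ ((2 ^ d * 2 ^ d : ℕ) : ℝ) := by exact_mod_cast Nat.mul_le_mul h2 h2
        _ = 4 ^ d := by push_cast; rw [← mul_pow]; norm_num
    refine (Finset.sum_le_sum fun a _ => h a).trans (le_of_eq ?_)
    simp
    ring
  -- Only finitely many windows and unitaries occur, so one null set serves the uncountably many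
  -- operators `O`.
  · have hall : ∀ᵐ x ∂μ, ∀ (a : Fin (N + 1)) w, ∀ i j,
        ‖star (ψ x i) ⬝ᵥ (embed (window N a d) (weyl w) *ᵥ ψ x j) -
          if i = j then l a w else 0‖ ^ 2 ≤ c ^ 2 * Real.exp (-S x) * Z a w x :=
      ae_all_iff.mpr fun a => ae_all_iff.mpr fun w => hbd a w
    filter_upwards [hall] with x hx a' O hO
    rw [← window_min_eq] at hO
    obtain ⟨a, ha⟩ : ∃ a : Fin (N + 1), (a : ℕ) = min a' N :=
      ⟨⟨min a' N, by omega⟩, rfl⟩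
    rw [← ha] at hO
    obtain ⟨o, hOo, ho⟩ := hO.exists_eq_sum_smul_embed_weyl
    refine ⟨∑ w, o w * l a w, fun i j => ?_⟩
    set D := fun w => star (ψ x i) ⬝ᵥ (embed (window N a d) (weyl w) *ᵥ ψ x j) -
          if i = j then l a w else 0
    have hdev : star (ψ x i) ⬝ᵥ (O *ᵥ ψ x j) - (if i = j then ∑ w, o w * l a w else 0)
        = ∑ w, star (star (o w)) * D w := by
      conv_lhs => rw [hOo]
      simp only [sum_mulVec, dotProduct_sum, smul_mulVec, dotProduct_smul, smul_eq_mul, D,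
        star_star, mul_sub, Finset.sum_sub_distrib]
      split_ifs <;> simp
    rw [hdev]
    have hcs := norm_sum_star_mul_sq_le Finset.univ (fun w => star (o w)) D
    simp only [norm_star] at hcs
    have hD : ∑ w, ‖D w‖ ^ 2 ≤ c ^ 2 * Real.exp (-S x) * ∑ a, ∑ w, Z a w x := by
      refine (Finset.sum_le_sum fun w _ => hx a w i j).trans ?_
      rw [← Finset.mul_sum]
      gcongr
      exact Finset.single_le_sum (f := fun a => ∑ w, Z a w x)
        (fun a _ => Finset.sum_nonneg fun w _ => hpos a w x) (Finset.mem_univ a)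
    have hZ : 0 ≤ ∑ a, ∑ w, Z a w x :=
      Finset.sum_nonneg fun a _ => Finset.sum_nonneg fun w _ => hpos a w x
    refine le_of_sq_le_sq ?_ (by positivity)
    refine hcs.trans ((mul_le_mul ho hD (by positivity) (by positivity)).trans (le_of_eq ?_))
    have h1 : Real.exp (-S x / 2) ^ 2 = Real.exp (-S x) := by
      rw [← Real.exp_nat_mul]; congr 1; push_cast; ring
    rw [mul_pow, mul_pow, mul_pow, Real.sq_sqrt hZ, h1]
    ring

end Probability

/-! ### Markov's inequality and the final exponent. -/

theorem natCast_add_one_le_four_mul_exp_log (N : ℕ) :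
    (N : ℝ) + 1 ≤ 4 * Real.exp (Real.log N) := by
  rcases Nat.eq_zero_or_pos N with rfl | h
  -- On the empty chain `Real.log 0 = 0`, so the right-hand side is 4.
  · simp
  · have h1 : (1 : ℝ) ≤ N := by exact_mod_cast h
    rw [Real.exp_log (by linarith)]
    linarith

end ETHCode

end

open MeasureTheory in
theorem theorem1 (c : ℝ) (hc : 0 < c) :
    ∃ K : ℝ, 0 < K ∧
      ∀ (N k d : ℕ) (Ω : Type*) [MeasurableSpace Ω] (μ : MeasureTheory.Measure Ω)
        [MeasureTheory.IsProbabilityMeasure μ]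
        -- the Hamiltonian, and the energies and eigenstates that span the code
        (H : Ω → ETHCode.Op N) (e : Ω → Fin (2 ^ k) → ℝ) (ψ : Ω → Fin (2 ^ k) → ETHCode.Ket N)
        -- energy and half-width of the shell, inverse temperature, growth rate
        (E Δ β lam : ℝ)
        -- the observable, time scales and tolerances that define the growth rate
        (A₀ : ETHCode.Op N) (td ts M η : ℝ),
        0 < β →
        (∀ x, (H x).IsHermitian) →
        (∀ᵐ x ∂μ, ETHCode.IsShellFamily (H x) E Δ (e x) (ψ x)) →
        -- the width of the shell is intensive, its entropy is extensive
        (∀ᵐ x ∂μ, β * (2 * Δ) + 2 * Real.log N ≤ ETHCode.microEntropy (H x) E Δ) →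
        (∀ A : ETHCode.Op N, ETHCode.IsLocalObservable d A →
          ETHCode.SatisfiesETH μ β c E (fun x => ETHCode.microEntropy (H x) E Δ) e ψ A) →
        ETHCode.IsLocalObservable d A₀ →
        (∀ᵐ x ∂μ, ETHCode.HasGrowthRate (H x) A₀ β lam td ts M η) →
        lam = 2 * Real.pi / β →
        ∀ δ : ℝ, 0 < δ → δ < 1 →
          μ {x | ¬ ∀ i j, ETHCode.IsAQECC k d
              (K / Real.sqrt δ * (2 ^ (d + 2 * k) *
                Real.exp (-(ETHCode.microEntropy (H x) E Δ) / 4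
                  - Real.pi / (2 * lam) * |e x i - e x j|)))
              (Submodule.span ℂ (Set.range (ψ x)))} ≤ ENNReal.ofReal δ := by
  refine ⟨8 * c, by positivity, ?_⟩
  intro N k d Ω _ μ _ H e ψ E Δ β lam A₀ td ts M η hβ _ hshell hS hETH _ _ hlam δ hδ _
  obtain ⟨Z, hint, hpos, hmean, hKL⟩ :=
    ETHCode.exists_uniform_fluctuation_bound hβ hc.le hETH
  -- The mean bound of `Z` divided by `δ`, so that Markov's inequality gives failure probability at
  -- most `δ`.
  set t : ℝ := (N + 1) * 4 ^ d * (4 * ((2 ^ k : ℕ) : ℝ) ^ 2) / δ with ht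
  have htpos : 0 < t := by positivity
  have hrate : Real.pi / (2 * lam) = β / 4 := by
    rw [hlam]
    field_simp
    norm_num
  have hmarkov : μ {x | t ≤ Z x} ≤ ENNReal.ofReal δ := by
    have h := mul_meas_ge_le_integral_of_nonneg (Filter.Eventually.of_forall hpos) hint t
    have h2 : t * μ.real {x | t ≤ Z x} ≤ t * δ := by
      refine (h.trans hmean).trans (le_of_eq ?_)
      rw [ht, div_mul_cancel₀ _ hδ.ne']
    rw [← ofReal_measureReal]
    exact ENNReal.ofReal_le_ofReal (le_of_mul_le_mul_left h2 htpos)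
  have hsqrt : √t ≤ 4 * Real.exp (Real.log N / 2) * 2 ^ d * 2 ^ k / √δ := by
    rw [Real.sqrt_le_left (by positivity)]
    have h1 : Real.exp (Real.log N / 2) ^ 2 = Real.exp (Real.log N) := by
      rw [← Real.exp_nat_mul]; congr 1; push_cast; ring
    have h2 : ((2 : ℝ) ^ d) ^ 2 = 4 ^ d := by rw [← pow_mul, mul_comm, pow_mul]; norm_num
    rw [div_pow, mul_pow, mul_pow, mul_pow, h1, h2, Real.sq_sqrt hδ.le, ht]
    have h3 := mul_le_mul_of_nonneg_right (ETHCode.natCast_add_one_le_four_mul_exp_log N)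
      (by positivity : (0 : ℝ) ≤ 4 ^ d * (4 * (2 ^ k) ^ 2))
    push_cast
    refine div_le_div_of_nonneg_right ?_ hδ.le
    linarith
  refine le_trans (measure_mono_ae ?_) hmarkov
  filter_upwards [hshell, hS, hKL] with x hx hSx hKLx hbad
  change t ≤ Z x
  by_contra hZ
  refine hbad fun i j => ?_
  set s := ETHCode.microEntropy (H x) E Δ
  refine ETHCode.isAQECC_of_approx_knillLaflamme (ψ x) hx.orthonormal
    (κ := c * Real.exp (-s / 2) * √t) (by positivity) (fun a O hO => ?_) ?_
  · obtain ⟨l, hl⟩ := hKLx a O hO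
    refine ⟨l, fun i j => (hl i j).trans ?_⟩
    have := Real.sqrt_le_sqrt (not_le.mp hZ).le
    open scoped Matrix.Norms.L2Operator in gcongr
  · have hω : |e x i - e x j| ≤ 2 * Δ := by
      have hi := hx.mem_shell i
      have hj := hx.mem_shell j
      rw [Set.mem_Icc] at hi hj
      rw [abs_le]
      constructor <;> linarith
    have hexp : Real.exp (-s / 2) * Real.exp (Real.log N / 2)
        ≤ Real.exp (-s / 4 - Real.pi / (2 * lam) * |e x i - e x j|) := by
      rw [← Real.exp_add, hrate, Real.exp_le_exp]
      -- A quarter of the shell condition, with `β * |ω| ≤ β * (2 * Δ)`, gives `β * |ω| / 4 + log N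
      -- / 2 ≤ s / 4`.
      nlinarith [mul_le_mul_of_nonneg_left hω hβ.le]
    -- The constant `8 * c` is the decoder's 2 times the 4 in the bound on `√t`. One factor `2 ^ k`
    -- comes from the decoder, the other from summing over matrix entries.
    calc 2 * (c * Real.exp (-s / 2) * √t) * 2 ^ k
        ≤ 2 * (c * Real.exp (-s / 2) *
            (4 * Real.exp (Real.log N / 2) * 2 ^ d * 2 ^ k / √δ)) * 2 ^ k := by gcongr
      _ = 8 * c / √δ * (2 ^ (d + 2 * k) *
            (Real.exp (-s / 2) * Real.exp (Real.log N / 2))) := by ring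
      _ ≤ _ := by gcongr
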